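/- Let $M$ be a matroid on $n$ elements that is representable over a field $K$; that is, there is a matrix over $K$ with columns indexed by the elements of $M$ such that a set of elements is independent in $M$ if and only if the corresponding family of columns is linearly independent over $K$. Then $M$ is representable over some simple algebraic extension $L = P(a)$ of the prime field $P$ of $K$, where $a$ is algebraic over $P$, of degree $$[L:P] \le 2^{2^{2n^2}}.$$ -/

import Mathlib

universe u v

/-- A matroid `M` is representable over the field `F` if there is a matrix over `F` with finitely
many rows and with columns indexed by the elements of `M`, such that a set of elements is
independent in `M` if and only if the family of the corresponding columns is linearly independent.
(Columns indexed by elements of the ambient type outside the ground set play no role.) -/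
def Matroid.IsRepresentableOver {α : Type u} (M : Matroid α) (F : Type v) [Field F] : Prop :=
  ∃ (m : ℕ) (A : Matrix (Fin m) α F), ∀ I ⊆ M.E, M.Indep I ↔ LinearIndepOn F A.col I

/-- `L` is a simple algebraic extension of `k`: it is generated as a field over `k` by a single
algebraic element. -/
def IsSimpleAlgebraicExtension (k : Type u) (L : Type v) [Field k] [Field L] [Algebra k L] : Prop :=
  ∃ a : L, IsAlgebraic k a ∧ IntermediateField.adjoin k {a} = ⊤

/-!
The linear dependencies among the columns of a matrix are described by the vanishing of some minors
and the non-vanishing of others, that is, by a system of polynomial equations and one inequation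
`g ≠ 0` in the entries. Such a system, solvable over `K`, is solved over a small extension of `P`
by eliminating the variables one at a time. Univariate polynomials `fᵢ` of degree at most `d` have a
common root, in some extension, that is not a root of `g` if and only if `g ^ d` lies outside the
ideal of the `fᵢ`. Division bounds the degrees of the cofactors, so this says that a vector lies
outside the row space of a matrix, which is again expressed by minors, now in the remaining
variables and of degree at most `d ^ 4`. On the way back each variable costs an adjunction of a root
of a polynomial of degree at most `d + 1`. An independent family of `n` vectors is realised over `P`
itself; any other family spans a space of dimension less than `n`, and saving one coordinate in this
way brings the exponent down to `2 * n ^ 2`.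
-/

section Minors

variable {K σ τ : Type*} [Field K]

theorem linearIndependent_row_iff_exists_det_submatrix_ne_zero {m : Type*} [Fintype m]
    [DecidableEq m] [Finite τ] (A : Matrix m τ K) :
    LinearIndependent K A.row ↔ ∃ c : m → τ, (A.submatrix id c).det ≠ 0 := by
  have := Fintype.ofFinite τ
  constructor
  · intro hA
    obtain ⟨f, hf, -, hfli⟩ := Submodule.exists_fun_fin_finrank_span_eq K (Set.range A.col)
    let e : m ≃ Fin (Module.finrank K (Submodule.span K (Set.range A.col))) :=
      Fintype.equivFinOfCardEq (by rw [← A.rank_eq_finrank_span_cols, hA.rank_matrix])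
    choose c hc using hf
    have hcols : LinearIndependent K (A.submatrix id (c ∘ e)).col := by
      have : (A.submatrix id (c ∘ e)).col = f ∘ e := funext fun j => hc (e j)
      exact this ▸ hfli.comp _ e.injective
    exact ⟨c ∘ e, (Matrix.isUnit_iff_isUnit_det _).1
      (Matrix.linearIndependent_cols_iff_isUnit.1 hcols) |>.ne_zero⟩
  · rintro ⟨c, hc⟩
    exact LinearIndependent.of_comp (LinearMap.funLeft K K c)
      (Matrix.linearIndependent_rows_of_det_ne_zero hc)

theorem finrank_span_row_lt_iff_forall_det_submatrix_eq_zero [Finite τ] (A : Matrix σ τ K)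
    (k : ℕ) :
    Module.finrank K (Submodule.span K (Set.range A.row)) < k ↔
      ∀ (r : Fin k → σ) (c : Fin k → τ), (A.submatrix r c).det = 0 := by
  rw [← not_iff_not]
  push Not
  constructor
  · intro hk
    obtain ⟨f, hf, -, hfli⟩ := Submodule.exists_fun_fin_finrank_span_eq K (Set.range A.row)
    choose r hr using hf
    have hli : LinearIndependent K (A.submatrix (r ∘ Fin.castLE hk) id).row := by
      have : (A.submatrix (r ∘ Fin.castLE hk) id).row = f ∘ Fin.castLE hk :=
        funext fun i => hr (Fin.castLE hk i)
      exact this ▸ hfli.comp _ (Fin.castLE_injective hk)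
    exact ⟨_, (linearIndependent_row_iff_exists_det_submatrix_ne_zero _).1 hli⟩
  · rintro ⟨r, c, hdet⟩
    have hli : LinearIndependent K (A.row ∘ r) :=
      (linearIndependent_row_iff_exists_det_submatrix_ne_zero (A.submatrix r id)).2 ⟨c, hdet⟩
    calc k = Module.finrank K (Submodule.span K (Set.range (A.row ∘ r))) := by
          rw [finrank_span_eq_card hli, Fintype.card_fin]
      _ ≤ _ := Submodule.finrank_mono (Submodule.span_mono (Set.range_comp_subset_range r A.row))

/-- The minor of `A` with rows `r` and columns `c`, bordered from above by the row `u`. -/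
def borderedMinor {R : Type*} [CommRing R] {k : ℕ} (u : τ → R) (A : Matrix σ τ R)
    (r : Fin k → σ) (c : Fin (k + 1) → τ) : R :=
  (Matrix.of (Matrix.vecCons (u ∘ c) (A.submatrix r c))).det

theorem map_borderedMinor {R S : Type*} [CommRing R] [CommRing S] (φ : R →+* S) {k : ℕ}
    (u : τ → R) (A : Matrix σ τ R) (r : Fin k → σ) (c : Fin (k + 1) → τ) :
    φ (borderedMinor u A r c) = borderedMinor (φ ∘ u) (A.map φ) r c := by
  rw [borderedMinor, borderedMinor, RingHom.map_det]
  congr 1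
  ext i j
  cases i using Fin.cases <;> rfl

theorem notMem_span_row_iff_exists_borderedMinor_ne_zero [Finite τ] (u : τ → K)
    (A : Matrix σ τ K) :
    u ∉ Submodule.span K (Set.range A.row) ↔
      ∃ ρ < Nat.card τ, (∀ (r : Fin (ρ + 1) → σ) (c : Fin (ρ + 1) → τ),
        (A.submatrix r c).det = 0) ∧
        ∃ (r : Fin ρ → σ) (c : Fin (ρ + 1) → τ), borderedMinor u A r c ≠ 0 := by
  have hbordered {ρ : ℕ} (r : Fin ρ → σ) :
      LinearIndependent K (Matrix.vecCons u (A.row ∘ r)) ↔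
        ∃ c : Fin (ρ + 1) → τ, borderedMinor u A r c ≠ 0 := by
    refine (linearIndependent_row_iff_exists_det_submatrix_ne_zero
      (Matrix.of (Matrix.vecCons u (A.submatrix r id)))).trans (exists_congr fun c => ?_)
    rw [borderedMinor]
    congr! 2
    ext i j
    cases i using Fin.cases <;> rfl
  constructor
  · intro hu
    obtain ⟨f, hf, hspan, hfli⟩ := Submodule.exists_fun_fin_finrank_span_eq K (Set.range A.row)
    choose r hr using hf
    have hli : LinearIndependent K (Matrix.vecCons u (A.row ∘ r)) := by
      rw [show A.row ∘ r = f from funext hr]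
      exact linearIndependent_finCons.2 ⟨hfli, by rwa [hspan]⟩
    refine ⟨_, ?_, (finrank_span_row_lt_iff_forall_det_submatrix_eq_zero A _).1
      (Nat.lt_succ_self _), r, (hbordered r).1 hli⟩
    have := Fintype.ofFinite τ
    simpa [Nat.succ_le_iff] using hli.fintype_card_le_finrank
  · rintro ⟨ρ, -, hminors, r, hr⟩ hu
    have hli := (hbordered r).2 hr
    have hle : Submodule.span K (Set.range (Matrix.vecCons u (A.row ∘ r))) ≤
        Submodule.span K (Set.range A.row) := by
      rw [Submodule.span_le, Matrix.range_cons, Set.union_subset_iff, Set.singleton_subset_iff]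
      exact ⟨hu, (Set.range_comp_subset_range r A.row).trans Submodule.subset_span⟩
    have hlt := (finrank_span_row_lt_iff_forall_det_submatrix_eq_zero A _).2 hminors
    have := (Submodule.finrank_mono hle).trans_lt hlt
    rw [finrank_span_eq_card hli, Fintype.card_fin] at this
    exact this.false

end Minors

section Univariate

open Polynomial

variable {F : Type*} [Field F]

theorem dvd_pow_of_forall_irreducible_dvd {g h : F[X]} (h0 : h ≠ 0)
    (hg : ∀ q, Irreducible q → q ∣ h → q ∣ g) {d : ℕ} (hd : h.natDegree ≤ d) : h ∣ g ^ d := by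
  induction h using WfDvdMonoid.induction_on_irreducible generalizing d with
  | zero => exact absurd rfl h0
  | unit u hu => exact hu.dvd
  | mul a q ha hq ih =>
    rw [natDegree_mul hq.ne_zero ha] at hd
    have hq_pos := hq.natDegree_pos
    obtain ⟨d, rfl⟩ : ∃ e, d = e + 1 := ⟨d - 1, by omega⟩
    rw [pow_succ']
    exact mul_dvd_mul (hg q hq (dvd_mul_right _ _))
      (ih ha (fun p hp hpa => hg p hp (hpa.mul_left _)) (by omega))

theorem exists_irreducible_natDegree_le_not_dvd {g : F[X]} (hg : g ≠ 0) :
    ∃ q : F[X], Irreducible q ∧ q.natDegree ≤ g.natDegree + 1 ∧ ¬ q ∣ g := by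
  -- Euclid's argument for the infinitude of primes
  have hdeg : (X * g + 1).natDegree = g.natDegree + 1 := by
    rw [← C_1, natDegree_add_C, natDegree_X_mul hg]
  have hne : X * g + 1 ≠ 0 := ne_zero_of_natDegree_gt (n := g.natDegree) (by omega)
  obtain ⟨q, hq, hqd⟩ := exists_irreducible_of_natDegree_ne_zero (f := X * g + 1) (by omega)
  refine ⟨q, hq, hdeg ▸ natDegree_le_of_dvd hqd hne, fun hqg => hq.not_isUnit ?_⟩
  exact isUnit_of_dvd_one ((dvd_add_right (hqg.mul_left X)).1 hqd)

theorem exists_irreducible_dvd_not_dvd_of_pow_notMem {S : Set F[X]} {g : F[X]} {d : ℕ}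
    (hS : ∀ f ∈ S, f.natDegree ≤ d) (hgd : g.natDegree ≤ d) (hd : d ≠ 0)
    (h : g ^ d ∉ Ideal.span S) :
    ∃ q : F[X], Irreducible q ∧ q.natDegree ≤ d + 1 ∧ (∀ f ∈ S, q ∣ f) ∧ ¬ q ∣ g := by
  obtain ⟨p, hp : Ideal.span S = Ideal.span {p}⟩ :=
    IsPrincipalIdealRing.principal (Ideal.span S)
  have hpS : ∀ f ∈ S, p ∣ f := fun f hf =>
    Ideal.mem_span_singleton.1 (hp ▸ Ideal.subset_span hf)
  rw [hp, Ideal.mem_span_singleton] at h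
  by_cases hS0 : ∀ f ∈ S, f = 0
  · have hg : g ≠ 0 := by
      rintro rfl
      exact h (by simp [hd])
    obtain ⟨q, hq, hqd, hqg⟩ := exists_irreducible_natDegree_le_not_dvd hg
    exact ⟨q, hq, by omega, fun f hf => by simp [hS0 f hf], hqg⟩
  · push Not at hS0
    obtain ⟨f, hf, hf0⟩ := hS0
    have hp0 : p ≠ 0 := ne_zero_of_dvd_ne_zero hf0 (hpS f hf)
    have hpd : p.natDegree ≤ d := (natDegree_le_of_dvd (hpS f hf) hf0).trans (hS f hf)
    obtain ⟨q, hq, hqp, hqg⟩ : ∃ q, Irreducible q ∧ q ∣ p ∧ ¬ q ∣ g := by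
      by_contra! hall
      exact h (dvd_pow_of_forall_irreducible_dvd hp0 hall hpd)
    have hqd := natDegree_le_of_dvd hqp hp0
    exact ⟨q, hq, by omega, fun f hf => hqp.trans (hpS f hf), hqg⟩

theorem mul_mem_span_X_pow_mul {ι : Type*} (f : ι → F[X]) {m : ℕ} {c : F[X]}
    (hc : c.natDegree ≤ m) (i : ι) :
    c * f i ∈ Submodule.span F (Set.range fun s : ι × Fin (m + 1) => X ^ (s.2 : ℕ) * f s.1) := by
  rw [c.as_sum_range_C_mul_X_pow' (Nat.lt_succ_of_le hc), Finset.sum_mul]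
  refine Submodule.sum_mem _ fun j hj => ?_
  rw [mul_assoc, ← smul_eq_C_mul]
  exact Submodule.smul_mem _ _
    (Submodule.subset_span ⟨(i, ⟨j, Finset.mem_range.1 hj⟩), rfl⟩)

theorem exists_eq_sum_mul_add_mul_of_mem_ideal_span {ι : Type*} {f : ι → F[X]} {p : F[X]}
    (hp : p ∈ Ideal.span (Set.range f)) {i₀ : ι} (hi₀ : f i₀ ≠ 0) :
    ∃ (s : Finset ι) (r : ι → F[X]) (c : F[X]),
      (∀ i, (r i).natDegree ≤ (f i₀).natDegree) ∧ p = ∑ i ∈ s, r i * f i + c * f i₀ := by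
  obtain ⟨c, rfl⟩ := Finsupp.mem_span_range_iff_exists_finsupp.1 hp
  refine ⟨c.support, fun i => c i % f i₀, ∑ i ∈ c.support, (c i / f i₀) * f i,
    fun i => natDegree_le_natDegree (degree_mod_lt _ hi₀).le, ?_⟩
  rw [Finsupp.sum, Finset.sum_mul, ← Finset.sum_add_distrib]
  refine Finset.sum_congr rfl fun i _ => ?_
  calc c i * f i = (c i % f i₀ + f i₀ * (c i / f i₀)) * f i := by
        rw [EuclideanDomain.mod_add_div]
    _ = _ := by ring

theorem mem_span_X_pow_mul_of_mem_ideal_span {ι : Type*} {f : ι → F[X]} {p : F[X]} {d m : ℕ}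
    (hf : ∀ i, (f i).natDegree ≤ d) (hdm : 2 * d ≤ m) (hpm : p.natDegree ≤ m)
    (hp : p ∈ Ideal.span (Set.range f)) :
    p ∈ Submodule.span F (Set.range fun s : ι × Fin (m + 1) => X ^ (s.2 : ℕ) * f s.1) := by
  by_cases h0 : ∀ i, f i = 0
  · have : p = 0 := by
      rwa [Ideal.span_eq_bot.2 (Set.forall_mem_range.2 h0), Ideal.mem_bot] at hp
    exact this ▸ Submodule.zero_mem _
  push Not at h0
  obtain ⟨i₀, hi₀⟩ := h0
  -- Reducing every coefficient but that of `f i₀` modulo `f i₀` leaves a combination in which the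
  -- degree of `p` also bounds the degree of the remaining coefficient `c`.
  obtain ⟨s, r, c, hr, hprc⟩ := exists_eq_sum_mul_add_mul_of_mem_ideal_span hp hi₀
  have hrd (i : ι) : (r i).natDegree ≤ d := (hr i).trans (hf i₀)
  have hsum : (∑ i ∈ s, r i * f i).natDegree ≤ m :=
    natDegree_sum_le_of_forall_le _ _ fun i _ =>
      natDegree_mul_le.trans ((add_le_add (hrd i) (hf i)).trans (by omega))
  have hcm : c.natDegree ≤ m := by
    rcases eq_or_ne c 0 with rfl | hc
    · simp
    calc c.natDegree ≤ (c * f i₀).natDegree := by rw [natDegree_mul hc hi₀]; omega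
      _ = (p - ∑ i ∈ s, r i * f i).natDegree := by rw [hprc, add_sub_cancel_left]
      _ ≤ m := (natDegree_sub_le _ _).trans (max_le hpm hsum)
  rw [hprc]
  exact Submodule.add_mem _
    (Submodule.sum_mem _ fun i _ => mul_mem_span_X_pow_mul f ((hrd i).trans (by omega)) i)
    (mul_mem_span_X_pow_mul f hcm i₀)

theorem toFn_mem_span_range_iff {R ι : Type*} [CommSemiring R] {N : ℕ} {p : R[X]}
    {q : ι → R[X]} (hp : p.natDegree < N) (hq : ∀ i, (q i).natDegree < N) :
    toFn N p ∈ Submodule.span R (Set.range fun i => toFn N (q i)) ↔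
      p ∈ Submodule.span R (Set.range q) := by
  classical
  constructor <;> intro h
  · have := Submodule.mem_map_of_mem (f := ofFn N) h
    rw [Submodule.map_span, ← Set.range_comp] at this
    simpa only [Function.comp_def, ofFn_comp_toFn_eq_id_of_natDegree_lt, hp, hq] using this
  · have := Submodule.mem_map_of_mem (f := toFn N) h
    rwa [Submodule.map_span, ← Set.range_comp] at this

end Univariate

open scoped Polynomial

section Systems

open MvPolynomial

/-- A possibly infinite system of polynomial equations `f = 0` together with one inequation `g ≠ 0`,
in the variables `σ`; its solutions form a basic constructible set. -/
structure PolynomialSystem (σ R : Type*) [CommSemiring R] where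
  equations : Set (MvPolynomial σ R)
  inequation : MvPolynomial σ R

namespace PolynomialSystem

variable {σ τ R A B : Type*} [CommSemiring R] [CommSemiring A] [Algebra R A] [CommSemiring B]
  [Algebra R B]

/-- The point `a`, with coordinates in an arbitrary `R`-algebra, solves the system. -/
def IsSolution (s : PolynomialSystem σ R) (a : σ → A) : Prop :=
  (∀ f ∈ s.equations, aeval a f = 0) ∧ aeval a s.inequation ≠ 0

/-- All polynomials of the system have total degree at most `d`. -/
def DegreeLE (s : PolynomialSystem σ R) (d : ℕ) : Prop :=
  (∀ f ∈ s.equations, f.totalDegree ≤ d) ∧ s.inequation.totalDegree ≤ d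

theorem DegreeLE.mono {s : PolynomialSystem σ R} {d e : ℕ} (hs : s.DegreeLE d) (hde : d ≤ e) :
    s.DegreeLE e :=
  ⟨fun f hf => (hs.1 f hf).trans hde, hs.2.trans hde⟩

theorem isSolution_algebraMap_comp_iff [Algebra A B] [IsScalarTower R A B] [FaithfulSMul A B]
    {s : PolynomialSystem σ R} {a : σ → A} :
    s.IsSolution (algebraMap A B ∘ a) ↔ s.IsSolution a := by
  simp only [IsSolution, ne_eq,
    aeval_algebraMap_eq_zero_iff_of_injective B (FaithfulSMul.algebraMap_injective A B)]

/-- Renaming the variables of a system. -/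
noncomputable def rename (e : σ → τ) (s : PolynomialSystem σ R) : PolynomialSystem τ R where
  equations := MvPolynomial.rename e '' s.equations
  inequation := MvPolynomial.rename e s.inequation

theorem DegreeLE.rename {s : PolynomialSystem σ R} {d : ℕ} (hs : s.DegreeLE d) (e : σ → τ) :
    (s.rename e).DegreeLE d :=
  ⟨Set.forall_mem_image.2 fun f hf => (totalDegree_rename_le e f).trans (hs.1 f hf),
    (totalDegree_rename_le e _).trans hs.2⟩

theorem isSolution_rename_iff {s : PolynomialSystem σ R} {e : σ → τ} {a : τ → A} :
    (s.rename e).IsSolution a ↔ s.IsSolution (a ∘ e) := by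
  simp only [IsSolution, rename, Set.forall_mem_image, aeval_rename]

end PolynomialSystem

theorem totalDegree_det_le {R σ m : Type*} [CommRing R] [Fintype m] [DecidableEq m]
    {A : Matrix m m (MvPolynomial σ R)} {e : m → ℕ}
    (hA : ∀ i j, (A i j).totalDegree ≤ e i) :
    A.det.totalDegree ≤ ∑ i, e i := by
  rw [Matrix.det_apply]
  refine totalDegree_finsetSum_le fun s _ => ?_
  have hprod : (∏ i, A (s i) i).totalDegree ≤ ∑ i, e i := by
    refine (totalDegree_finsetProd _ _).trans ?_
    rw [← Equiv.sum_comp s e]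
    exact Finset.sum_le_sum fun i _ => hA _ _
  rcases Int.units_eq_one_or (Equiv.Perm.sign s) with hs | hs <;> simpa [hs] using hprod

section SpanSystem

variable {P ι σ τ : Type*} [CommRing P] {ρ d e N : ℕ} {u : τ → MvPolynomial ι P}
  {W : Matrix σ τ (MvPolynomial ι P)}

theorem totalDegree_det_submatrix_le (hW : ∀ s t, (W s t).totalDegree ≤ d) (r : Fin ρ → σ)
    (c : Fin ρ → τ) : (W.submatrix r c).det.totalDegree ≤ ρ * d := by
  simpa using totalDegree_det_le (A := W.submatrix r c) (e := fun _ => d) fun i j => hW _ _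

theorem totalDegree_borderedMinor_le (hu : ∀ t, (u t).totalDegree ≤ e)
    (hW : ∀ s t, (W s t).totalDegree ≤ d) (r : Fin ρ → σ) (c : Fin (ρ + 1) → τ) :
    (borderedMinor u W r c).totalDegree ≤ e + ρ * d := by
  refine (totalDegree_det_le (e := Matrix.vecCons e fun _ => d) fun i j => ?_).trans_eq
    (by simp [Fin.sum_univ_succ])
  cases i using Fin.cases with
  | zero => exact hu _
  | succ i => exact hW _ _

/-- The system expressing that the matrix `W` has rank at most `ρ` while its minor with rows `r`
and columns `c`, bordered by `u`, does not vanish: it forces `u` out of the row space of `W`. -/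
noncomputable def spanSystem (u : τ → MvPolynomial ι P)
    (W : Matrix σ τ (MvPolynomial ι P)) (r : Fin ρ → σ) (c : Fin (ρ + 1) → τ) :
    PolynomialSystem ι P where
  equations := Set.range fun q : (Fin (ρ + 1) → σ) × (Fin (ρ + 1) → τ) =>
    (W.submatrix q.1 q.2).det
  inequation := borderedMinor u W r c

theorem degreeLE_spanSystem (hu : ∀ t, (u t).totalDegree ≤ e)
    (hW : ∀ s t, (W s t).totalDegree ≤ d) (hde : d ≤ e) (hρ : ρ ≤ N) (r : Fin ρ → σ)
    (c : Fin (ρ + 1) → τ) : (spanSystem u W r c).DegreeLE (e + N * d) := by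
  constructor
  · rintro _ ⟨q, rfl⟩
    calc _ ≤ (ρ + 1) * d := totalDegree_det_submatrix_le hW q.1 q.2
      _ = d + ρ * d := by ring
      _ ≤ e + N * d := by gcongr
  · calc _ ≤ e + ρ * d := totalDegree_borderedMinor_le hu hW r c
      _ ≤ e + N * d := by gcongr

theorem isSolution_spanSystem_iff {L : Type*} [CommRing L] [Algebra P L] {r : Fin ρ → σ}
    {c : Fin (ρ + 1) → τ} {b : ι → L} :
    (spanSystem u W r c).IsSolution b ↔
      (∀ (r' : Fin (ρ + 1) → σ) (c' : Fin (ρ + 1) → τ),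
        ((W.map (aeval b)).submatrix r' c').det = 0) ∧
      borderedMinor (aeval b ∘ u) (W.map (aeval b)) r c ≠ 0 := by
  refine and_congr ?_ (not_congr ?_)
  · simp only [spanSystem, Set.forall_mem_range, Prod.forall, AlgHom.map_det]
    rfl
  · exact (congrArg (· = 0) (map_borderedMinor (aeval b : _ →ₐ[P] L).toRingHom u W r c)).to_iff

theorem exists_system_forall_notMem_span_row {K : Type*} [Field K] [Algebra P K]
    (hu : ∀ i, (u i).totalDegree ≤ e) (hW : ∀ s i, (W s i).totalDegree ≤ d) (hde : d ≤ e)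
    [Finite τ] (hN : Nat.card τ ≤ N + 1) {a : ι → K}
    (ha : aeval a ∘ u ∉ Submodule.span K (Set.range (W.map (aeval a)).row)) :
    ∃ t : PolynomialSystem ι P, t.DegreeLE (e + N * d) ∧ t.IsSolution a ∧
      ∀ (L : Type v) [Field L] [Algebra P L] (b : ι → L), t.IsSolution b →
        aeval b ∘ u ∉ Submodule.span L (Set.range (W.map (aeval b)).row) := by
  obtain ⟨ρ, hρ, hminors, r, c, hc⟩ := (notMem_span_row_iff_exists_borderedMinor_ne_zero _ _).1 ha
  refine ⟨spanSystem u W r c, degreeLE_spanSystem hu hW hde (by omega) r c,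
    isSolution_spanSystem_iff.2 ⟨hminors, hc⟩, fun L _ _ b hb => ?_⟩
  obtain ⟨hbminors, hbc⟩ := isSolution_spanSystem_iff.1 hb
  exact (notMem_span_row_iff_exists_borderedMinor_ne_zero _ _).2 ⟨ρ, hρ, hbminors, r, c, hbc⟩

theorem mapAlgHom_mem_span_iff {A L : Type*} [CommRing A] [Algebra P A] [Field L] [Algebra P L]
    {φ : A →ₐ[P] L} {G : A[X]} {F : σ → A[X]} (hG : G.natDegree ≤ N)
    (hF : ∀ s, (F s).natDegree ≤ N) :
    Polynomial.mapAlgHom φ G ∈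
        Submodule.span L (Set.range fun s => Polynomial.mapAlgHom φ (F s)) ↔
      φ ∘ Polynomial.toFn (N + 1) G ∈ Submodule.span L
        (Set.range ((Matrix.of fun s => Polynomial.toFn (N + 1) (F s)).map φ).row) := by
  have hlt {p : A[X]} (hp : p.natDegree ≤ N) : (Polynomial.mapAlgHom φ p).natDegree < N + 1 :=
    Nat.lt_succ_of_le (Polynomial.natDegree_map_le.trans hp)
  have htoFn (p : A[X]) : Polynomial.toFn (N + 1) (Polynomial.mapAlgHom φ p) =
      φ ∘ Polynomial.toFn (N + 1) p := by
    ext i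
    simp [Polynomial.toFn]
  rw [← toFn_mem_span_range_iff (hlt hG) fun s => hlt (hF s)]
  simp only [htoFn]
  rfl

theorem exists_system_forall_notMem_span {K : Type*} [Field K] [Algebra P K]
    {G : (MvPolynomial ι P)[X]} {F : σ → (MvPolynomial ι P)[X]}
    (hG : G.natDegree ≤ N) (hF : ∀ s, (F s).natDegree ≤ N)
    (hGe : ∀ i, (G.coeff i).totalDegree ≤ e) (hFd : ∀ s i, ((F s).coeff i).totalDegree ≤ d)
    (hde : d ≤ e) {a : ι → K}
    (ha : Polynomial.mapAlgHom (aeval a) G ∉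
      Submodule.span K (Set.range fun s => Polynomial.mapAlgHom (aeval a) (F s))) :
    ∃ t : PolynomialSystem ι P, t.DegreeLE (e + N * d) ∧ t.IsSolution a ∧
      ∀ (L : Type v) [Field L] [Algebra P L] (b : ι → L), t.IsSolution b →
        Polynomial.mapAlgHom (aeval b) G ∉
          Submodule.span L (Set.range fun s => Polynomial.mapAlgHom (aeval b) (F s)) := by
  simp only [mapAlgHom_mem_span_iff hG hF] at ha ⊢
  exact exists_system_forall_notMem_span_row (u := Polynomial.toFn (N + 1) G)
    (W := Matrix.of fun s => Polynomial.toFn (N + 1) (F s)) (fun i => hGe i)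
    (fun s i => hFd s i) hde (by simp) ha

end SpanSystem

section Specialize

/-- The univariate polynomial over `L` obtained by evaluating all variables but the first at `b`. -/
noncomputable def specialize {R L : Type*} [CommSemiring R] [CommSemiring L] [Algebra R L]
    {k : ℕ} (b : Fin k → L) : MvPolynomial (Fin (k + 1)) R →ₐ[R] L[X] :=
  (Polynomial.mapAlgHom (aeval b)).comp (finSuccEquiv R k).toAlgHom

variable {R L : Type*} [CommSemiring R] [CommSemiring L] [Algebra R L] {k : ℕ}

theorem totalDegree_coeff_finSuccEquiv_le (f : MvPolynomial (Fin (k + 1)) R) (i : ℕ) :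
    ((finSuccEquiv R k f).coeff i).totalDegree ≤ f.totalDegree := by
  by_cases h : (finSuccEquiv R k f).coeff i = 0
  · simp [h]
  · exact (Nat.le_add_right _ _).trans (totalDegree_coeff_finSuccEquiv_add_le f i h)

theorem natDegree_finSuccEquiv_le (f : MvPolynomial (Fin (k + 1)) R) :
    (finSuccEquiv R k f).natDegree ≤ f.totalDegree :=
  (natDegree_finSuccEquiv f).trans_le (degreeOf_le_totalDegree f 0)

theorem natDegree_specialize_le (b : Fin k → L) (f : MvPolynomial (Fin (k + 1)) R) :
    (specialize b f).natDegree ≤ f.totalDegree :=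
  Polynomial.natDegree_map_le.trans (natDegree_finSuccEquiv_le f)

theorem aeval_specialize {A : Type*} [CommSemiring A] [Algebra R A] [Algebra L A]
    [IsScalarTower R L A] (b : Fin k → L) (x : A) (f : MvPolynomial (Fin (k + 1)) R) :
    Polynomial.aeval x (specialize b f) =
      aeval (Fin.cons x (algebraMap L A ∘ b) : Fin (k + 1) → A) f := by
  have : ((Polynomial.aeval x).restrictScalars R).comp (specialize b) =
      aeval (Fin.cons x (algebraMap L A ∘ b) : Fin (k + 1) → A) := by
    refine algHom_ext fun i => ?_
    cases i using Fin.cases <;> simp [specialize, finSuccEquiv_X_zero, finSuccEquiv_X_succ]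
  exact DFunLike.congr_fun this f

theorem isSolution_cons_root_iff {P L : Type*} [CommRing P] [CommRing L] [Algebra P L]
    {s : PolynomialSystem (Fin (k + 1)) P} {b : Fin k → L} {q : L[X]} :
    s.IsSolution (Fin.cons (AdjoinRoot.root q) (algebraMap L (AdjoinRoot q) ∘ b) :
        Fin (k + 1) → AdjoinRoot q) ↔
      (∀ f ∈ s.equations, q ∣ specialize b f) ∧ ¬ q ∣ specialize b s.inequation := by
  simp only [PolynomialSystem.IsSolution, ← aeval_specialize, AdjoinRoot.aeval_eq,
    AdjoinRoot.mk_eq_zero, ne_eq]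

end Specialize

section Elimination

theorem notMem_span_X_pow_mul_of_eval {F ι κ : Type*} [Field F] {f : ι → F[X]} {g : F[X]} {x : F}
    (hf : ∀ i, (f i).eval x = 0) (hg : g.eval x ≠ 0) (e : κ → ℕ) :
    g ∉ Submodule.span F (Set.range fun s : ι × κ => Polynomial.X ^ e s.2 * f s.1) := by
  have hle : Submodule.span F (Set.range fun s : ι × κ => Polynomial.X ^ e s.2 * f s.1) ≤
      LinearMap.ker (Polynomial.leval x) := by
    rw [Submodule.span_le]
    rintro _ ⟨s, rfl⟩
    simp [hf]
  exact fun hmem => hg (hle hmem)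

section XPow

variable {R : Type*} [CommSemiring R] {k d : ℕ} {f : MvPolynomial (Fin (k + 1)) R}

theorem mapAlgHom_X_pow_mul_finSuccEquiv {L : Type*} [CommSemiring L] [Algebra R L]
    (b : Fin k → L) (j : ℕ) (f : MvPolynomial (Fin (k + 1)) R) :
    Polynomial.mapAlgHom (aeval b) (Polynomial.X ^ j * finSuccEquiv R k f) =
      Polynomial.X ^ j * specialize b f := by
  simp [specialize]

theorem natDegree_X_pow_mul_finSuccEquiv_le {j m : ℕ} (hf : f.totalDegree ≤ d) (hj : j ≤ m) :
    (Polynomial.X ^ j * finSuccEquiv R k f).natDegree ≤ m + d :=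
  Polynomial.natDegree_mul_le.trans
    (add_le_add ((Polynomial.natDegree_X_pow_le j).trans hj)
      ((natDegree_finSuccEquiv_le f).trans hf))

theorem totalDegree_coeff_X_pow_mul_finSuccEquiv_le (hf : f.totalDegree ≤ d) (j i : ℕ) :
    ((Polynomial.X ^ j * finSuccEquiv R k f).coeff i).totalDegree ≤ d := by
  rw [Polynomial.coeff_X_pow_mul']
  split_ifs
  · exact (totalDegree_coeff_finSuccEquiv_le f _).trans hf
  · simp

end XPow

variable {P : Type*} {K : Type*} [Field P] [Field K] [Algebra P K] {k d : ℕ}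

theorem exists_system_forall_specialize_pow_notMem_span (hd : 2 ≤ d)
    {s : PolynomialSystem (Fin (k + 1)) P} (hs : s.DegreeLE d)
    {a : Fin (k + 1) → K} (ha : s.IsSolution a) :
    ∃ t : PolynomialSystem (Fin k) P, t.DegreeLE (d ^ 4) ∧ t.IsSolution (Fin.tail a) ∧
      ∀ (L : Type v) [Field L] [Algebra P L] (b : Fin k → L), t.IsSolution b →
        specialize b s.inequation ^ d ∉
          Submodule.span L (Set.range fun p : s.equations × Fin (d ^ 2 + 1) =>
            Polynomial.X ^ (p.2 : ℕ) * specialize b (p.1 : MvPolynomial (Fin (k + 1)) P)) := by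
  have heval (f : MvPolynomial (Fin (k + 1)) P) :
      (specialize (Fin.tail a) f).eval (a 0) = aeval a f := by
    rw [← Polynomial.coe_aeval_eq_eval, aeval_specialize]
    congr 2
    exact Fin.cons_self_tail a
  have hspan : specialize (Fin.tail a) (s.inequation ^ d) ∉ Submodule.span K
      (Set.range fun p : s.equations × Fin (d ^ 2 + 1) => Polynomial.X ^ (p.2 : ℕ) *
        specialize (Fin.tail a) (p.1 : MvPolynomial (Fin (k + 1)) P)) :=
    notMem_span_X_pow_mul_of_eval (x := a 0) (fun f => (heval _).trans (ha.1 _ f.2))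
      (by rw [heval, map_pow]; exact pow_ne_zero d ha.2) _
  have hpow : (s.inequation ^ d).totalDegree ≤ d ^ 2 :=
    (totalDegree_pow _ _).trans (sq d ▸ Nat.mul_le_mul_left d hs.2)
  simp only [← mapAlgHom_X_pow_mul_finSuccEquiv, ← map_pow] at hspan ⊢
  obtain ⟨t, ht, hta, htb⟩ := exists_system_forall_notMem_span (N := d ^ 2 + d)
    ((natDegree_finSuccEquiv_le (s.inequation ^ d)).trans (by omega))
    (fun p : s.equations × Fin (d ^ 2 + 1) => natDegree_X_pow_mul_finSuccEquiv_le
      (hs.1 _ p.1.2) (Nat.le_of_lt_succ p.2.2))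
    (fun i => (totalDegree_coeff_finSuccEquiv_le _ i).trans hpow)
    (fun p => totalDegree_coeff_X_pow_mul_finSuccEquiv_le (hs.1 _ p.1.2) _) (by nlinarith) hspan
  refine ⟨t, ht.mono ?_, hta, htb⟩
  calc d ^ 2 + (d ^ 2 + d) * d = d ^ 2 * (d + 2) := by ring
    _ ≤ d ^ 2 * d ^ 2 := by gcongr; nlinarith
    _ = d ^ 4 := by ring

theorem exists_elimination (hd : 2 ≤ d) {s : PolynomialSystem (Fin (k + 1)) P}
    (hs : s.DegreeLE d) {a : Fin (k + 1) → K} (ha : s.IsSolution a) :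
    ∃ t : PolynomialSystem (Fin k) P, t.DegreeLE (d ^ 4) ∧ t.IsSolution (Fin.tail a) ∧
      ∀ (L : Type v) [Field L] [Algebra P L] (b : Fin k → L), t.IsSolution b →
        ∃ q : L[X], Irreducible q ∧ q.natDegree ≤ d + 1 ∧
          (∀ f ∈ s.equations, q ∣ specialize b f) ∧ ¬ q ∣ specialize b s.inequation := by
  obtain ⟨t, ht, hta, htb⟩ :=
    exists_system_forall_specialize_pow_notMem_span.{v} hd hs ha
  refine ⟨t, ht, hta, fun L _ _ b hb => ?_⟩
  have hdeg (f : s.equations) : (specialize b (f : MvPolynomial (Fin (k + 1)) P)).natDegree ≤ d :=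
    (natDegree_specialize_le b _).trans (hs.1 _ f.2)
  have hgdeg : (specialize b s.inequation).natDegree ≤ d :=
    (natDegree_specialize_le b _).trans hs.2
  have hpow : (specialize b s.inequation ^ d).natDegree ≤ d ^ 2 :=
    Polynomial.natDegree_pow_le.trans (by nlinarith)
  have h2d : 2 * d ≤ d ^ 2 := by nlinarith
  have hg : specialize b s.inequation ^ d ∉
      Ideal.span (Set.range fun f : s.equations => specialize b f.1) := by
    intro hmem
    have := mem_span_X_pow_mul_of_mem_ideal_span hdeg h2d hpow hmem
    exact htb L b hb this
  obtain ⟨q, hq, hqd, hqS, hqg⟩ := exists_irreducible_dvd_not_dvd_of_pow_notMem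
    (Set.forall_mem_range.2 hdeg) hgdeg (by omega) hg
  exact ⟨q, hq, hqd, fun f hf => hqS _ ⟨⟨f, hf⟩, rfl⟩, hqg⟩

end Elimination

section Solutions

theorem exists_isSolution_fin_finrank_mul_le {P : Type v} {K : Type*} [Field P] [Field K]
    [Algebra P K] {k d : ℕ} (hd : 2 ≤ d) {s : PolynomialSystem (Fin k) P} (hs : s.DegreeLE d)
    {a : Fin k → K} (ha : s.IsSolution a) :
    ∃ (L : Type v) (_ : Field L) (_ : Algebra P L), FiniteDimensional P L ∧
      Module.finrank P L * d ≤ d ^ 4 ^ k ∧ ∃ b : Fin k → L, s.IsSolution b := by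
  induction k generalizing d with
  | zero =>
    refine ⟨P, inferInstance, inferInstance, inferInstance, by simp, Fin.elim0, ?_⟩
    rwa [← PolynomialSystem.isSolution_algebraMap_comp_iff (B := K),
      Subsingleton.elim (algebraMap P K ∘ Fin.elim0) a]
  | succ k ih =>
    obtain ⟨t, ht, hta, hroot⟩ := exists_elimination.{v} hd hs ha
    obtain ⟨F, _, _, _, hF, b, hb⟩ := ih (hd.trans (Nat.le_self_pow (by norm_num) d)) ht hta
    obtain ⟨q, hq, hqd, hqs⟩ := hroot F b hb
    have : Fact (Irreducible q) := ⟨hq⟩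
    have : FiniteDimensional F (AdjoinRoot q) := (AdjoinRoot.powerBasis hq.ne_zero).finite
    refine ⟨AdjoinRoot q, inferInstance, inferInstance,
      FiniteDimensional.trans P F (AdjoinRoot q), ?_, _, isSolution_cons_root_iff.2 hqs⟩
    have hfinrank : Module.finrank F (AdjoinRoot q) = q.natDegree :=
      finrank_quotient_span_eq_natDegree
    have hd4 : q.natDegree * d ≤ d ^ 4 := by
      calc q.natDegree * d ≤ (d + 1) * d := by gcongr
        _ ≤ d ^ 2 * d ^ 2 := by gcongr <;> nlinarith
        _ = d ^ 4 := by ring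
    calc Module.finrank P (AdjoinRoot q) * d = Module.finrank P F * (q.natDegree * d) := by
          rw [← Module.finrank_mul_finrank P F, hfinrank, mul_assoc]
      _ ≤ Module.finrank P F * d ^ 4 := by gcongr
      _ ≤ (d ^ 4) ^ 4 ^ k := hF
      _ = d ^ 4 ^ (k + 1) := by rw [← pow_mul, pow_succ']

theorem exists_isSolution_finrank_mul_le {P : Type v} {K σ : Type*} [Field P] [Field K]
    [Algebra P K] [Finite σ] {d : ℕ} (hd : 2 ≤ d) {s : PolynomialSystem σ P}
    (hs : s.DegreeLE d) {a : σ → K} (ha : s.IsSolution a) :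
    ∃ (L : Type v) (_ : Field L) (_ : Algebra P L), FiniteDimensional P L ∧
      Module.finrank P L * d ≤ d ^ 4 ^ Nat.card σ ∧ ∃ b : σ → L, s.IsSolution b := by
  let e := Finite.equivFin σ
  have hae : (s.rename e).IsSolution (a ∘ e.symm) := by
    rwa [PolynomialSystem.isSolution_rename_iff, Function.comp_assoc, e.symm_comp_self]
  obtain ⟨L, _, _, hfin, hL, b, hb⟩ := exists_isSolution_fin_finrank_mul_le hd (hs.rename e) hae
  exact ⟨L, _, _, hfin, hL, b ∘ e, PolynomialSystem.isSolution_rename_iff.1 hb⟩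

end Solutions

section Independence

variable {P K E κ : Type*} [CommRing P] [Field K] [Algebra P K] [DecidableEq E]

/-- The maximal minor with columns `c` of the rows in `I` of the generic `E × κ` matrix. -/
noncomputable def genericMinor (P : Type*) [CommRing P] {E κ : Type*} [DecidableEq E]
    (I : Finset E) (c : I → κ) : MvPolynomial (E × κ) P :=
  ((Matrix.mvPolynomialX E κ P).submatrix (↑) c).det

theorem totalDegree_genericMinor_le [Nontrivial P] (I : Finset E) (c : I → κ) :
    (genericMinor P I c).totalDegree ≤ I.card := by
  refine (totalDegree_det_le (e := fun _ => 1) fun i j => (totalDegree_X _).le).trans ?_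
  simp

theorem aeval_genericMinor {A : Matrix E κ K} (I : Finset E) (c : I → κ) :
    aeval (Function.uncurry A) (genericMinor P I c) = (A.submatrix (↑) c).det := by
  rw [genericMinor, AlgHom.map_det]
  congr 1
  ext i j
  exact aeval_X _ _

theorem linearIndepOn_row_iff_exists_aeval_genericMinor_ne_zero [Finite κ] {A : Matrix E κ K}
    {I : Finset E} :
    LinearIndepOn K A.row I ↔
      ∃ c : I → κ, aeval (Function.uncurry A) (genericMinor P I c) ≠ 0 := by
  simp only [aeval_genericMinor]
  exact linearIndependent_row_iff_exists_det_submatrix_ne_zero (A.submatrix ((↑) : I → E) id)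

/-- The system, in the entries of an `E × κ` matrix, whose equations say that the rows in `I` are
linearly dependent for `I ∉ 𝓘`, and whose inequation says that the minor with rows `I` and columns
`c I` does not vanish for `I ∈ 𝓘`. -/
noncomputable def independenceSystem (P : Type*) [CommRing P] {E κ : Type*} [DecidableEq E]
    (𝓘 : Finset (Finset E)) (c : ∀ I : 𝓘, I.1 → κ) : PolynomialSystem (E × κ) P where
  equations := {f | ∃ I ∉ 𝓘, ∃ c : I → κ, genericMinor P I c = f}
  inequation := ∏ I : 𝓘, genericMinor P I.1 (c I)

theorem degreeLE_independenceSystem [Nontrivial P] [Fintype E] (𝓘 : Finset (Finset E))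
    (c : ∀ I : 𝓘, I.1 → κ) :
    (independenceSystem P 𝓘 c).DegreeLE (Fintype.card E * 2 ^ Fintype.card E) := by
  have hminor (I : Finset E) (c : I → κ) : (genericMinor P I c).totalDegree ≤ Fintype.card E :=
    (totalDegree_genericMinor_le I c).trans I.card_le_univ
  constructor
  · rintro _ ⟨I, -, c, rfl⟩
    exact (hminor I c).trans (Nat.le_mul_of_pos_right _ (by positivity))
  · calc _ ≤ ∑ _ : 𝓘, Fintype.card E :=
          (totalDegree_finsetProd _ _).trans (Finset.sum_le_sum fun I _ => hminor _ _)
      _ = Fintype.card E * 𝓘.card := by simp [mul_comm]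
      _ ≤ Fintype.card E * 2 ^ Fintype.card E := by
          rw [← Fintype.card_finset]
          gcongr
          exact 𝓘.card_le_univ

theorem exists_isSolution_independenceSystem_iff [Finite κ] {𝓘 : Finset (Finset E)}
    {A : Matrix E κ K} :
    (∃ c, (independenceSystem P 𝓘 c).IsSolution (Function.uncurry A)) ↔
      ∀ I : Finset E, LinearIndepOn K A.row I ↔ I ∈ 𝓘 := by
  constructor
  · rintro ⟨c, hdep, hindep⟩ I
    rw [linearIndepOn_row_iff_exists_aeval_genericMinor_ne_zero (P := P)]
    refine ⟨fun ⟨c, hc⟩ => ?_, fun hI => ⟨c ⟨I, hI⟩, ?_⟩⟩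
    · by_contra hI
      exact hc (hdep _ ⟨I, hI, c, rfl⟩)
    · rw [independenceSystem, map_prod, Finset.prod_ne_zero_iff] at hindep
      exact hindep ⟨I, hI⟩ (Finset.mem_univ _)
  · intro h
    simp only [linearIndepOn_row_iff_exists_aeval_genericMinor_ne_zero (P := P)] at h
    choose c hc using fun I : 𝓘 => (h I).2 I.2
    refine ⟨c, ?_, ?_⟩
    · rintro _ ⟨I, hI, c', rfl⟩
      by_contra hne
      exact hI ((h I).1 ⟨c', hne⟩)
    · simpa only [independenceSystem, map_prod, Finset.prod_ne_zero_iff] using fun I _ => hc I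

theorem mul_two_pow_self_le_two_pow_four_pow (n : ℕ) : n * 2 ^ n ≤ 2 ^ 4 ^ n := by
  calc n * 2 ^ n ≤ 2 ^ n * 2 ^ n := Nat.mul_le_mul_right _ Nat.lt_two_pow_self.le
    _ = 2 ^ (2 * n) := by ring
    _ ≤ 2 ^ 2 ^ (2 * n) := Nat.pow_le_pow_right two_pos Nat.lt_two_pow_self.le
    _ = 2 ^ 4 ^ n := by rw [pow_mul, show 2 ^ 2 = 4 from rfl]

end Independence

theorem exists_linearIndepOn_row_iff_finrank_le {P : Type v} {K E κ : Type*} [Field P] [Field K]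
    [Algebra P K] [Fintype E] [Finite κ] (A : Matrix E κ K) :
    ∃ (L : Type v) (_ : Field L) (_ : Algebra P L), FiniteDimensional P L ∧
      Module.finrank P L ≤ 2 ^ 4 ^ (Fintype.card E * (Nat.card κ + 1)) ∧
      ∃ B : Matrix E κ L, ∀ I : Set E, LinearIndepOn L B.row I ↔ LinearIndepOn K A.row I := by
  classical
  let 𝓘 : Finset (Finset E) := {I | LinearIndepOn K A.row I}
  have h𝓘 (I : Finset E) : LinearIndepOn K A.row I ↔ I ∈ 𝓘 := by simp [𝓘]
  obtain ⟨c, hA⟩ := (exists_isSolution_independenceSystem_iff (P := P)).2 h𝓘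
  have hdeg := (degreeLE_independenceSystem (P := P) 𝓘 c).mono
    (mul_two_pow_self_le_two_pow_four_pow (Fintype.card E))
  have h2 : 2 ≤ 2 ^ 4 ^ Fintype.card E := Nat.le_self_pow (by positivity) 2
  obtain ⟨L, _, _, hfin, hL, b, hb⟩ :=
    exists_isSolution_finrank_mul_le h2 hdeg hA
  refine ⟨L, _, _, hfin, ?_, Function.curry b, fun I => ?_⟩
  · calc Module.finrank P L ≤ Module.finrank P L * 2 ^ 4 ^ Fintype.card E :=
          Nat.le_mul_of_pos_right _ (by positivity)
      _ ≤ (2 ^ 4 ^ Fintype.card E) ^ 4 ^ Nat.card (E × κ) := hL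
      _ = 2 ^ 4 ^ (Fintype.card E * (Nat.card κ + 1)) := by
          rw [← pow_mul, ← pow_add, Nat.card_prod, Nat.card_eq_fintype_card]
          ring_nf
  · lift I to Finset E using I.toFinite
    rw [h𝓘]
    exact (exists_isSolution_independenceSystem_iff (P := P) (A := Function.curry b)).1
      ⟨c, hb⟩ I

end Systems

section Representations

open Module

theorem exists_linearIndepOn_iff_of_not_linearIndependent {K V E : Type*} [Field K]
    [AddCommGroup V] [Module K V] [Fintype E] {v : E → V} (hv : ¬ LinearIndependent K v) :
    ∃ r < Fintype.card E, ∃ A : E → Fin r → K,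
      ∀ I : Set E, LinearIndepOn K A I ↔ LinearIndepOn K v I := by
  let W := Submodule.span K (Set.range v)
  have hlt : finrank K W < Fintype.card E :=
    not_le.1 fun h => hv (linearIndependent_iff_card_le_finrank_span.2 h)
  have : Module.Finite K W := Module.Finite.span_of_finite K (Set.finite_range v)
  let φ : W ≃ₗ[K] (Fin (finrank K W) → K) := (finBasis K W).equivFun
  let w : E → W := fun i => ⟨v i, Submodule.subset_span ⟨i, rfl⟩⟩
  refine ⟨_, hlt, φ ∘ w, fun I => ?_⟩
  calc LinearIndepOn K (φ ∘ w) I ↔ LinearIndepOn K w I :=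
        φ.toLinearMap.linearIndepOn_iff_of_injOn φ.injective.injOn
    _ ↔ LinearIndepOn K (W.subtype ∘ w) I :=
        (W.subtype.linearIndepOn_iff_of_injOn W.injective_subtype.injOn).symm

theorem exists_linearIndepOn_iff_finrank_le {P : Type v} {K V E : Type*} [Field P] [Field K]
    [Algebra P K] [AddCommGroup V] [Module K V] [Fintype E] (v : E → V) :
    ∃ (L : Type v) (_ : Field L) (_ : Algebra P L), FiniteDimensional P L ∧
      finrank P L ≤ 2 ^ (2 ^ (2 * Fintype.card E ^ 2)) ∧
      ∃ (r : ℕ) (B : E → Fin r → L), ∀ I : Set E, LinearIndepOn L B I ↔ LinearIndepOn K v I := by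
  by_cases hv : LinearIndependent K v
  · have hbasis : LinearIndependent P (Pi.basisFun P (Fin (Fintype.card E)) ∘ Fintype.equivFin E) :=
      (Pi.basisFun P _).linearIndependent.comp _ (Fintype.equivFin E).injective
    refine ⟨P, inferInstance, inferInstance, inferInstance, ?_, _, _, fun I =>
      iff_of_true (hbasis.linearIndepOn I) (hv.linearIndepOn I)⟩
    exact (finrank_self P).trans_le Nat.one_le_two_pow
  · obtain ⟨r, hr, A, hA⟩ := exists_linearIndepOn_iff_of_not_linearIndependent hv
    obtain ⟨L, _, _, hfin, hL, B, hB⟩ :=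
      exists_linearIndepOn_row_iff_finrank_le (P := P) (Matrix.of A)
    refine ⟨L, _, _, hfin, hL.trans (Nat.pow_le_pow_right two_pos ?_), r, B,
      fun I => (hB I).trans (hA I)⟩
    calc 4 ^ (Fintype.card E * (Nat.card (Fin r) + 1)) ≤ 4 ^ (Fintype.card E * Fintype.card E) := by
          rw [Nat.card_fin]
          gcongr
          · norm_num
          · omega
      _ = 2 ^ (2 * Fintype.card E ^ 2) := by
        rw [← sq, pow_mul 2, show 2 ^ 2 = 4 from rfl]

theorem isRepresentableOver_iff_exists_linearIndepOn_iff {α : Type u} {M : Matroid α}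
    {F : Type v} [Field F] :
    M.IsRepresentableOver F ↔ ∃ (m : ℕ) (v : M.E → Fin m → F),
      ∀ I : Set M.E, M.Indep (Subtype.val '' I) ↔ LinearIndepOn F v I := by
  have hcomp {m : ℕ} (w : α → Fin m → F) (I : Set M.E) :
      LinearIndepOn F w (Subtype.val '' I) ↔ LinearIndepOn F (w ∘ Subtype.val) I :=
    ⟨fun h => h.comp_of_image Subtype.val_injective.injOn,
      fun h => LinearIndepOn.image_of_comp Subtype.val w h⟩
  constructor
  · rintro ⟨m, A, hA⟩
    exact ⟨m, A.col ∘ Subtype.val, fun I =>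
      (hA _ (Subtype.coe_image_subset _ _)).trans (hcomp A.col I)⟩
  · rintro ⟨m, v, hv⟩
    let w : α → Fin m → F := Function.extend Subtype.val v 0
    have hw : w ∘ Subtype.val = v := Function.extend_comp Subtype.val_injective v 0
    refine ⟨m, (Matrix.of w).transpose, fun I hI => ?_⟩
    obtain ⟨J, rfl⟩ : ∃ J : Set M.E, Subtype.val '' J = I :=
      ⟨Subtype.val ⁻¹' I, by rwa [Subtype.image_preimage_coe, Set.inter_eq_right]⟩
    rw [hv, ← hw, ← hcomp]
    rfl

theorem isSimpleAlgebraicExtension_of_finiteDimensional (k : Type u) (L : Type v) [Field k]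
    [PerfectField k] [Field L] [Algebra k L] [FiniteDimensional k L] :
    IsSimpleAlgebraicExtension k L := by
  obtain ⟨a, ha⟩ := Field.exists_primitive_element k L
  exact ⟨a, Algebra.IsAlgebraic.isAlgebraic a, ha⟩

theorem perfectField_bot_subfield (K : Type*) [Field K] : PerfectField (⊥ : Subfield K) := by
  obtain ⟨p, hp⟩ := CharP.exists K
  rcases CharP.char_is_prime_or_zero K p with h | rfl
  · have := Fact.mk h
    have := Subfield.fintypeBot K p
    infer_instance
  · have := CharP.charP_to_charZero K
    have : CharZero (⊥ : Subfield K) := (algebraMap (⊥ : Subfield K) K).charZero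
    infer_instance

end Representations

theorem theorem1p1_general {α : Type u} (M : Matroid α) (n : ℕ) (hn : M.E.encard = n)
    (P : Type v) [Field P] [PerfectField P] (K : Type*) [Field K] [Algebra P K]
    (hM : M.IsRepresentableOver K) :
    ∃ (L : Type v) (_ : Field L) (_ : Algebra P L),
      IsSimpleAlgebraicExtension P L ∧
      FiniteDimensional P L ∧
      Module.finrank P L ≤ 2 ^ (2 ^ (2 * n ^ 2)) ∧
      M.IsRepresentableOver L := by
  have := (Set.finite_of_encard_eq_coe hn).fintype
  have hcard : Fintype.card M.E = n := by
    rw [Set.fintypeCard_eq_ncard, Set.ncard, hn, ENat.toNat_natCast]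
  obtain ⟨m, v, hv⟩ := isRepresentableOver_iff_exists_linearIndepOn_iff.1 hM
  obtain ⟨L, _, _, _, hL, r, B, hB⟩ := exists_linearIndepOn_iff_finrank_le (P := P) (K := K) v
  exact ⟨L, _, _, isSimpleAlgebraicExtension_of_finiteDimensional P L, ‹_›, hcard ▸ hL,
    isRepresentableOver_iff_exists_linearIndepOn_iff.2 ⟨r, B, fun I => (hv I).trans (hB I).symm⟩⟩

/-- `(⊥ : Subfield K)` is the prime field of `K`. -/
theorem theorem1p1 {α : Type u} (M : Matroid α) (n : ℕ) (hn : M.E.encard = n)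
    (K : Type v) [Field K] (hM : M.IsRepresentableOver K) :
    ∃ (L : Type v) (_ : Field L) (_ : Algebra (⊥ : Subfield K) L),
      IsSimpleAlgebraicExtension (⊥ : Subfield K) L ∧
      FiniteDimensional (⊥ : Subfield K) L ∧
      Module.finrank (⊥ : Subfield K) L ≤ 2 ^ (2 ^ (2 * n ^ 2)) ∧
      M.IsRepresentableOver L := by
  have := perfectField_bot_subfield K
  exact theorem1p1_general M n hn (⊥ : Subfield K) K hM
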